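/- Let $E$ be a (real) vector lattice, let $F$ be a (real) normed lattice, i.e. a vector lattice with a norm such that $|x|\le|y|$ implies $\|x\|\le\|y\|$, and let $T:E\to F$ be a linear operator. Write $x\perp y$ for $|x|\wedge|y|=0$. A net $(x_\alpha)$ in $E$ is order convergent to $x$ if there is a net $(z_\beta)$ in $E$ with $z_\beta\downarrow 0$ (decreasing with infimum $0$) such that for every $\beta$ there is $\alpha_0$ with $|x_\alpha-x|\le z_\beta$ for all $\alpha\ge\alpha_0$; it is $uo$-convergent to $x$ if $|x_\alpha-x|\wedge u$ is order convergent to $0$ for every $u\in E^+$. The operator $T$ is called $\sigma$-$uon$-continuous if $\|Tx_n\|\to0$ for every sequence $(x_n)$ in $E$ that is $uo$-convergent to $0$, and order bounded if it maps subsets of order intervals to subsets of order intervals. Linear operators are ordered by $S\le S'$ iff $Sx\le S'x$ for all $x\in E^+$, and the modulus $|T|$ is said to exist if $T$ and $-T$ have a least upper bound $|T|=T\vee(-T)$ among all linear operators from $E$ to $F$. **Theorem.** Let $T:E\to F$ be order bounded and $\sigma$-$uon$-continuous. Suppose that at least one of the following conditions holds. 1. $E$ is Dedekind $\sigma$-complete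 (every nonempty countable subset that is bounded above has a supremum) and laterally $\sigma$-complete (every nonempty countable set of pairwise disjoint positive vectors has a supremum), and $F$ is atomic (the smallest band of $F$ containing all its atoms is $F$, where an atom is a nonzero $a\in F^+$ such that $x,y\in[0,a]$ and $x\perp y$ imply $x=0$ or $y=0$, and a band is an ideal closed under order convergence) and has order continuous norm ($z_\beta\downarrow0$ implies $\|z_\beta\|\to0$ for every net $(z_\beta)$ in $F$). 2. $T$ preserves disjointness: $x\perp y$ in $E$ implies $Tx\perp Ty$ in $F$. Then the modulus $|T|$ exists and is $\sigma$-$uon$-continuous. -/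

import Mathlib

open Filter Topology

universe u v

namespace RieszSpace

section VectorLattice

variable {E : Type u} [AddCommGroup E] [Lattice E] [Module ℝ E]

/-- `x ⊥ y`, that is `|x| ∧ |y| = 0`. -/
def Disj (x y : E) : Prop := |x| ⊓ |y| = 0

/-- `z_β ↓ 0`: the net `z` is decreasing and its infimum is `0`. -/
def DecreasesToZero {β : Type*} [Preorder β] (z : β → E) : Prop :=
  Antitone z ∧ IsGLB (Set.range z) 0

/-- Order convergence `x_α → a`: there is a net `z_β ↓ 0` such that for every `β` one has
`|x_α - a| ≤ z_β` for all sufficiently large `α`. The index sets of the dominating nets may be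
taken in the universe of `E`, since such a net can be replaced by its range. -/
def OrderConverges {α : Type*} [Preorder α] (x : α → E) (a : E) : Prop :=
  ∃ (β : Type u) (_ : Preorder β) (_ : IsDirectedOrder β) (_ : Nonempty β) (z : β → E),
    DecreasesToZero z ∧ ∀ b : β, ∃ i₀ : α, ∀ i : α, i₀ ≤ i → |x i - a| ≤ z b

/-- Unbounded order convergence: `|x_α - a| ∧ w → 0` in order for every `w ≥ 0`. -/
def UOConverges {α : Type*} [Preorder α] (x : α → E) (a : E) : Prop :=
  ∀ w : E, 0 ≤ w → OrderConverges (fun i => |x i - a| ⊓ w) 0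

/-- Every nonempty countable subset that is bounded above has a supremum. -/
def DedekindSigmaComplete (E : Type u) [Lattice E] : Prop :=
  ∀ s : Set E, s.Nonempty → s.Countable → BddAbove s → ∃ x, IsLUB s x

/-- Every nonempty countable set of pairwise disjoint positive vectors has a supremum. -/
def LaterallySigmaComplete (E : Type u) [AddCommGroup E] [Lattice E] : Prop :=
  ∀ s : Set E, s.Nonempty → s.Countable → (∀ x ∈ s, 0 ≤ x) → s.Pairwise Disj → ∃ x, IsLUB s x

/-- A nonzero `a ≥ 0` such that disjoint `x, y ∈ [0, a]` satisfy `x = 0` or `y = 0`. -/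
def IsLatticeAtom (a : E) : Prop :=
  0 ≤ a ∧ a ≠ 0 ∧
    ∀ x ∈ Set.Icc 0 a, ∀ y ∈ Set.Icc 0 a, Disj x y → x = 0 ∨ y = 0

/-- A band: an ideal (solid linear subspace) that is closed under order convergence of nets. -/
def IsBand (B : Submodule ℝ E) : Prop :=
  LatticeOrderedAddCommGroup.IsSolid (B : Set E) ∧
    ∀ (α : Type u) [Preorder α] [IsDirectedOrder α] [Nonempty α] (x : α → E) (a : E),
      (∀ i, x i ∈ B) → OrderConverges x a → a ∈ B

/-- The band generated by the atoms, i.e. the smallest band containing them, is the whole space. -/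
def IsAtomicLattice (E : Type u) [AddCommGroup E] [Lattice E] [Module ℝ E] : Prop :=
  ∀ B : Submodule ℝ E, IsBand B → (∀ a : E, IsLatticeAtom a → a ∈ B) → B = ⊤

end VectorLattice

/-- The norm is order continuous: `z_β ↓ 0` implies `‖z_β‖ → 0`, for all nets. -/
def OrderContinuousNorm (F : Type v) [NormedAddCommGroup F] [Lattice F] : Prop :=
  ∀ (β : Type v) [Preorder β] [IsDirectedOrder β] [Nonempty β] (z : β → F),
    DecreasesToZero z → Tendsto (fun b => ‖z b‖) atTop (𝓝 0)

section Operators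

variable {E : Type u} [AddCommGroup E] [Lattice E] [Module ℝ E]
variable {F : Type v} [AddCommGroup F] [Lattice F] [Module ℝ F]

/-- `A` is contained in an order interval. -/
def OrderBounded (A : Set E) : Prop := ∃ a b : E, A ⊆ Set.Icc a b

/-- `T` maps order bounded sets to order bounded sets. -/
def OrderBoundedOperator (T : E →ₗ[ℝ] F) : Prop :=
  ∀ A : Set E, OrderBounded A → OrderBounded (T '' A)

/-- `x ⊥ y` implies `T x ⊥ T y`. -/
def DisjointnessPreserving (T : E →ₗ[ℝ] F) : Prop :=
  ∀ x y : E, Disj x y → Disj (T x) (T y)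

/-- The order of operators: `S ≤ T` iff `S x ≤ T x` for all `x ≥ 0`. -/
def OperatorLE (S T : E →ₗ[ℝ] F) : Prop := ∀ x : E, 0 ≤ x → S x ≤ T x

/-- `R = |T| = T ∨ (-T)`: `R` is the least upper bound of `T` and `-T` among all linear operators
from `E` to `F`. -/
def IsModulus (T R : E →ₗ[ℝ] F) : Prop :=
  OperatorLE T R ∧ OperatorLE (-T) R ∧
    ∀ S : E →ₗ[ℝ] F, OperatorLE T S → OperatorLE (-T) S → OperatorLE R S

end Operators

/-- `T` is `σ`-`uon`-continuous: it maps `uo`-null sequences to norm null sequences. -/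
def SigmaUonContinuous {E : Type u} [AddCommGroup E] [Lattice E] [Module ℝ E]
    {F : Type v} [NormedAddCommGroup F] [NormedSpace ℝ F] (T : E →ₗ[ℝ] F) : Prop :=
  ∀ x : ℕ → E, UOConverges x 0 → Tendsto (fun n => T (x n)) atTop (𝓝 0)

end RieszSpace

set_option linter.unusedSectionVars false

namespace RieszSpace

/-! ### Disjointness and moduli in lattice-ordered groups. -/

section LatticeGroup

variable {G : Type u} [AddCommGroup G] [Lattice G] [IsOrderedAddMonoid G]

/-! If `T` preserves disjointness, the point is Meyer's theorem: `(T x)⁺ ⊓ (T y)⁻ = 0` for `x, y ≥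
0`. Then `|T (x + y)| = |T x| + |T y|` on the positive cone, so `x ↦ |T x|` extends to a linear `R`,
which is the modulus. Since `|R x| ≤ |T x⁺| + |T x⁻| ≤ |T x|`, the operator `R` inherits
`σ`-`uon`-continuity.

If `E` is Dedekind `σ`-complete, the problem reduces to that case. Disjoint sequences are `uo`-null
however they are rescaled, so `T` must vanish at some term of each of them. Hence, up to parts where
`T` vanishes, `E` has only finitely many disjoint pieces, each carried by an operator atom `a`: a
vector that cannot be split into two disjoint parts both seen by `T`. If `P` is the projection onto
the band of `a`, then `T ∘ P` preserves disjointness and so has a modulus. The remainder `T ∘ (id -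
P)` needs one atom fewer; by induction the moduli add up to that of `T`. -/

theorem inf_add_le_of_nonneg {a b c : G} (ha : 0 ≤ a) (hb : 0 ≤ b) (hc : 0 ≤ c) :
    a ⊓ (b + c) ≤ a ⊓ b + a ⊓ c := by
  rw [add_inf]
  refine le_inf ?_ ?_
  · exact inf_le_left.trans (le_add_of_nonneg_left (le_inf ha hb))
  · rw [inf_add]
    exact inf_le_inf (le_add_of_nonneg_right hc) le_rfl

theorem inf_add_eq_zero {a b c : G} (ha : 0 ≤ a) (hb : 0 ≤ b) (hc : 0 ≤ c)
    (hab : a ⊓ b = 0) (hac : a ⊓ c = 0) : a ⊓ (b + c) = 0 :=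
  le_antisymm ((inf_add_le_of_nonneg ha hb hc).trans (by simp [hab, hac]))
    (le_inf ha (add_nonneg hb hc))

theorem inf_eq_zero_of_le {a b a' b' : G} (ha : 0 ≤ a') (hb : 0 ≤ b') (haa : a' ≤ a)
    (hbb : b' ≤ b) (hab : a ⊓ b = 0) : a' ⊓ b' = 0 :=
  le_antisymm ((inf_le_inf haa hbb).trans hab.le) (le_inf ha hb)

theorem inf_nsmul_eq_zero {a b : G} (ha : 0 ≤ a) (hb : 0 ≤ b) (hab : a ⊓ b = 0) (n : ℕ) :
    a ⊓ n • b = 0 := by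
  induction n with
  | zero => simpa using ha
  | succ n ih => rw [succ_nsmul]; exact inf_add_eq_zero ha (nsmul_nonneg hb n) hb ih hab

theorem nsmul_inf_nsmul_eq_zero {a b : G} (ha : 0 ≤ a) (hb : 0 ≤ b) (hab : a ⊓ b = 0)
    (m n : ℕ) : m • a ⊓ n • b = 0 := by
  have h := inf_nsmul_eq_zero ha hb hab n
  rw [inf_comm] at h ⊢
  exact inf_nsmul_eq_zero (nsmul_nonneg hb n) ha h m

theorem add_eq_sup_of_inf_eq_zero {a b : G} (h : a ⊓ b = 0) : a + b = a ⊔ b := by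
  rw [← inf_add_sup a b, h, zero_add]

theorem abs_sub_eq_add_of_inf_eq_zero {a b : G} (h : a ⊓ b = 0) : |a - b| = a + b := by
  rw [abs_sub_comm, ← sup_sub_inf_eq_abs_sub, h, sub_zero, add_eq_sup_of_inf_eq_zero h]

theorem Disj.symm {x y : G} (h : Disj x y) : Disj y x :=
  (inf_comm _ _).trans h

theorem Disj.mono {x y x' y' : G} (h : Disj x y) (hx : |x'| ≤ |x|) (hy : |y'| ≤ |y|) :
    Disj x' y' :=
  inf_eq_zero_of_le (abs_nonneg _) (abs_nonneg _) hx hy h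

theorem posPart_le_abs (x : G) : x⁺ ≤ |x| :=
  sup_le (le_abs_self x) (abs_nonneg x)

theorem negPart_le_abs (x : G) : x⁻ ≤ |x| :=
  sup_le (neg_le_abs x) (abs_nonneg x)

theorem disj_posPart_negPart (x : G) : Disj x⁺ x⁻ := by
  rw [Disj, abs_of_nonneg (posPart_nonneg x), abs_of_nonneg (negPart_nonneg x),
    posPart_inf_negPart_eq_zero]

/-- Meeting `|a| ≤ |a - b| + |b|` with `|a|` kills the term `|b|`; symmetrically for `b`, and a
disjoint sum is a supremum. -/
theorem Disj.abs_add_abs_le {a b : G} (h : Disj a b) : |a| + |b| ≤ |a - b| := by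
  have key : ∀ c d : G, |c| ⊓ |d| = 0 → |c| ≤ |c - d| := fun c d hcd => by
    have h1 : |c| ≤ |c - d| + |d| := by simpa using abs_add_le (c - d) d
    calc |c| = |c| ⊓ (|c - d| + |d|) := (inf_eq_left.2 h1).symm
      _ ≤ |c| ⊓ |c - d| + |c| ⊓ |d| :=
        inf_add_le_of_nonneg (abs_nonneg _) (abs_nonneg _) (abs_nonneg _)
      _ ≤ |c - d| := by rw [hcd, add_zero]; exact inf_le_right
  rw [add_eq_sup_of_inf_eq_zero h]
  exact sup_le (key a b h) (by rw [abs_sub_comm]; exact key b a h.symm)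

/-- `p⁺ + q⁺` and `p⁻ + q⁻` are disjoint with difference `p + q`, so no cancellation occurs. -/
theorem abs_add_eq_of_posPart_inf_negPart {p q : G} (h₁ : p⁺ ⊓ q⁻ = 0) (h₂ : q⁺ ⊓ p⁻ = 0) :
    |p + q| = |p| + |q| := by
  have hp := posPart_inf_negPart_eq_zero p
  have hq := posPart_inf_negPart_eq_zero q
  have h0 : (p⁻ + q⁻) ⊓ (p⁺ + q⁺) = 0 := by
    refine inf_add_eq_zero (add_nonneg (negPart_nonneg p) (negPart_nonneg q))
      (posPart_nonneg p) (posPart_nonneg q) ?_ ?_ <;> rw [inf_comm]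
    · exact inf_add_eq_zero (posPart_nonneg p) (negPart_nonneg p) (negPart_nonneg q) hp h₁
    · exact inf_add_eq_zero (posPart_nonneg q) (negPart_nonneg p) (negPart_nonneg q) h₂ hq
  rw [inf_comm] at h0
  have e : p + q = (p⁺ + q⁺) - (p⁻ + q⁻) := by
    conv_lhs => rw [← posPart_sub_negPart p, ← posPart_sub_negPart q]
    abel
  rw [e, abs_sub_eq_add_of_inf_eq_zero h0, ← posPart_add_negPart p, ← posPart_add_negPart q]
  abel

theorem posPart_inf_negPart_nsmul_le (t r : G) (k m : ℕ) :
    (k • t + r)⁺ ⊓ (m • t - r)⁻ ≤ |r| := by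
  have h1 : (k • t + r)⁺ ≤ k • t⁺ + |r| :=
    sup_le (add_le_add (nsmul_le_nsmul_right (le_posPart t) k) (le_abs_self r))
      (add_nonneg (nsmul_nonneg (posPart_nonneg t) k) (abs_nonneg r))
  have h2 : (m • t - r)⁻ ≤ m • t⁻ + |r| := by
    refine sup_le ?_ (add_nonneg (nsmul_nonneg (negPart_nonneg t) m) (abs_nonneg r))
    rw [neg_sub, sub_eq_neg_add, ← smul_neg]
    exact add_le_add (nsmul_le_nsmul_right (neg_le_negPart t) m) (le_abs_self r)
  refine (inf_le_inf h1 h2).trans ?_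
  rw [← inf_add, nsmul_inf_nsmul_eq_zero (posPart_nonneg t) (negPart_nonneg t)
    (posPart_inf_negPart_eq_zero t), zero_add]

end LatticeGroup

/-! ### Scalars, and extension of maps from the positive cone. -/

section VectorLattice

variable {E : Type u} [AddCommGroup E] [Lattice E] [IsOrderedAddMonoid E]
  [Module ℝ E] [IsOrderedModule ℝ E]

theorem smul_sup_of_nonneg {c : ℝ} (hc : 0 ≤ c) (x y : E) : c • (x ⊔ y) = c • x ⊔ c • y := by
  rcases hc.eq_or_lt with rfl | hc
  · simp
  · exact (OrderIso.smulRight (β := E) hc).map_sup x y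

theorem smul_inf_of_nonneg {c : ℝ} (hc : 0 ≤ c) (x y : E) : c • (x ⊓ y) = c • x ⊓ c • y := by
  rcases hc.eq_or_lt with rfl | hc
  · simp
  · exact (OrderIso.smulRight (β := E) hc).map_inf x y

theorem abs_smul_of_nonneg {c : ℝ} (hc : 0 ≤ c) (x : E) : |c • x| = c • |x| := by
  rw [abs, abs, smul_sup_of_nonneg hc, smul_neg]

theorem Disj.smul_smul {c d : ℝ} (hc : 0 ≤ c) (hd : 0 ≤ d) {x y : E} (h : Disj x y) :
    Disj (c • x) (d • y) := by
  have hm : (max c d) • |x| ⊓ (max c d) • |y| = 0 := by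
    rw [← smul_inf_of_nonneg (hc.trans (le_max_left c d)), h, smul_zero]
  rw [Disj, abs_smul_of_nonneg hc, abs_smul_of_nonneg hd]
  exact inf_eq_zero_of_le (smul_nonneg hc (abs_nonneg x)) (smul_nonneg hd (abs_nonneg y))
    (smul_le_smul_of_nonneg_right (le_max_left c d) (abs_nonneg x))
    (smul_le_smul_of_nonneg_right (le_max_right c d) (abs_nonneg y)) hm

/-- A map that is additive and positively homogeneous on the positive cone extends to a linear
operator. -/
theorem exists_linearMap_of_cone {V : Type v} [AddCommGroup V] [Module ℝ V] (f : E → V)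
    (hadd : ∀ x y, 0 ≤ x → 0 ≤ y → f (x + y) = f x + f y)
    (hsmul : ∀ (c : ℝ) x, 0 ≤ c → 0 ≤ x → f (c • x) = c • f x) :
    ∃ R : E →ₗ[ℝ] V, ∀ x, 0 ≤ x → R x = f x := by
  have key : ∀ a b c d : E, 0 ≤ a → 0 ≤ b → 0 ≤ c → 0 ≤ d → a - b = c - d →
      f a - f b = f c - f d := fun a b c d ha hb hc hd h => by
    have h1 : a + d = c + b := by
      rw [sub_eq_sub_iff_add_eq_add] at h; exact h
    have h2 := congrArg f h1
    rw [hadd a d ha hd, hadd c b hc hb] at h2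
    rw [sub_eq_sub_iff_add_eq_add]; exact h2
  have hpos : ∀ (c : ℝ) (x : E), 0 ≤ c →
      f (c • x)⁺ - f (c • x)⁻ = c • (f x⁺ - f x⁻) := fun c x hc => by
    rw [smul_sub, ← hsmul c _ hc (posPart_nonneg x), ← hsmul c _ hc (negPart_nonneg x)]
    refine key _ _ _ _ (posPart_nonneg _) (negPart_nonneg _) (smul_nonneg hc (posPart_nonneg x))
      (smul_nonneg hc (negPart_nonneg x)) ?_
    rw [← smul_sub, posPart_sub_negPart, posPart_sub_negPart]
  refine ⟨{ toFun := fun x => f x⁺ - f x⁻, map_add' := fun x y => ?_, map_smul' := fun c x => ?_ },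
    fun x hx => ?_⟩
  · have := key (x + y)⁺ (x + y)⁻ (x⁺ + y⁺) (x⁻ + y⁻) (posPart_nonneg _) (negPart_nonneg _)
      (add_nonneg (posPart_nonneg _) (posPart_nonneg _))
      (add_nonneg (negPart_nonneg _) (negPart_nonneg _)) (by
        rw [add_sub_add_comm, posPart_sub_negPart, posPart_sub_negPart, posPart_sub_negPart])
    rw [this, hadd _ _ (posPart_nonneg _) (posPart_nonneg _),
      hadd _ _ (negPart_nonneg _) (negPart_nonneg _), add_sub_add_comm]
  · rcases le_total 0 c with hc | hc
    · exact hpos c x hc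
    · have h := hpos (-c) x (neg_nonneg.2 hc)
      rw [neg_smul, posPart_neg, negPart_neg, neg_smul] at h
      simpa using congrArg Neg.neg h
  · have h0 : f 0 = 0 := by simpa using hsmul 0 0 le_rfl le_rfl
    change f x⁺ - f x⁻ = f x
    rw [posPart_eq_self.2 hx, negPart_eq_zero.2 hx, h0, sub_zero]

theorem abs_apply_le_of_pos {V : Type v} [AddCommGroup V] [Lattice V] [IsOrderedAddMonoid V]
    [Module ℝ V] {R : E →ₗ[ℝ] V} (hR : ∀ x, 0 ≤ x → 0 ≤ R x) (x : E) : |R x| ≤ R |x| := by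
  refine abs_le'.2 ⟨?_, ?_⟩
  · simpa using hR _ (sub_nonneg.2 (le_abs_self x))
  · have := hR _ (sub_nonneg.2 (neg_le_abs x))
    rwa [map_sub, map_neg, sub_nonneg] at this

end VectorLattice

/-! ### The Archimedean property, forced by the norm. -/

section NormedLattice

variable {F : Type v} [NormedAddCommGroup F] [Lattice F] [HasSolidNorm F] [IsOrderedAddMonoid F]
  [NormedSpace ℝ F] [IsOrderedModule ℝ F]

theorem eq_zero_of_forall_le_smul {a w : F} (ha : 0 ≤ a)
    (h : ∀ n : ℕ, a ≤ (1 / ((n : ℝ) + 1)) • w) : a = 0 := by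
  have hn : ∀ n : ℕ, ‖a‖ ≤ 1 / ((n : ℝ) + 1) * ‖w‖ := fun n => by
    have := norm_le_norm_of_abs_le_abs
      ((abs_of_nonneg ha).le.trans ((h n).trans (le_abs_self _)))
    rwa [norm_smul, Real.norm_of_nonneg (by positivity)] at this
  have ht : Tendsto (fun n : ℕ => 1 / ((n : ℝ) + 1) * ‖w‖) atTop (𝓝 0) := by
    simpa using (tendsto_one_div_add_atTop_nhds_zero_nat (𝕜 := ℝ)).mul_const ‖w‖
  exact norm_le_zero_iff.1 (ge_of_tendsto' ht hn)

end NormedLattice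

/-! ### Meyer's theorem for disjointness preserving operators. -/

section DisjointnessPreserving

/-- Discretised Meyer argument: cut at the levels `k • v`. The excess `g` of the left side over `V`
is shown disjoint from each `T (x - k • v)⁻` in turn; past level `n` the positive part of `x - k •
v` is gone too, which forces `g = 0`. -/
theorem DisjointnessPreserving.posPart_inf_negPart_le
    {E : Type u} [AddCommGroup E] [Lattice E] [IsOrderedAddMonoid E] [Module ℝ E]
    {F : Type v} [AddCommGroup F] [Lattice F] [IsOrderedAddMonoid F] [Module ℝ F]
    {T : E →ₗ[ℝ] F} (hT : DisjointnessPreserving T) {x y v : E} {V : F} {n : ℕ}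
    (hx : 0 ≤ x) (hy : 0 ≤ y) (hv : 0 ≤ v) (hxy : x + y = n • v)
    (hV : ∀ w, 0 ≤ w → w ≤ v → |T w| ≤ V) : (T x)⁺ ⊓ (T y)⁻ ≤ V := by
  have hV0 : 0 ≤ V := (abs_nonneg _).trans (hV 0 le_rfl hv)
  set f : F := (T x)⁺ ⊓ (T y)⁻ with hf
  set g : F := (f - V)⁺ with hg
  have hg0 : 0 ≤ g := posPart_nonneg _
  have hTy : T y = n • T v - T x := by rw [← map_nsmul, ← hxy, map_add]; abel
  -- With `s = x - k • v`, the vector `r = T s` differs from `e = T (s - v)⁺ - T s⁻` by at most `V`,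
  -- while `f ≤ |r|`. So `h ≤ |e|`, yet `h` is disjoint from both terms of `e`.
  have step : ∀ k ≤ n, ∀ h : F, 0 ≤ h → h ≤ g → h ⊓ |T (x - k • v)⁻| = 0 →
      h ⊓ |T (x - (k + 1) • v)⁺| = 0 → h = 0 := by
    intro k hk h h0 hhg ha hb
    set s := x - k • v with hs
    have hs' : x - (k + 1) • v = s - v := by rw [hs, succ_nsmul]; abel
    rw [hs'] at hb
    set r := T x - k • T v with hr
    have hrd : r = T (s⁺ - (s - v)⁺) + (T (s - v)⁺ - T s⁻) := by
      have : T s⁺ - T s⁻ = r := by rw [← map_sub, posPart_sub_negPart, hs, map_sub, map_nsmul]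
      rw [map_sub, ← this]; abel
    have hw1 : 0 ≤ s⁺ - (s - v)⁺ := sub_nonneg.2 (posPart_mono (sub_le_self s hv))
    have hw2 : s⁺ - (s - v)⁺ ≤ v := by
      rw [sub_le_iff_le_add]
      refine sup_le ?_ (add_nonneg hv (posPart_nonneg _))
      have := add_le_add_right (le_posPart (s - v)) v
      simpa using this
    set e := T (s - v)⁺ - T s⁻ with he
    have hre : |r| ≤ V + |e| := by
      rw [hrd]; exact (abs_add_le _ _).trans (by gcongr; exact hV _ hw1 hw2)
    have hfr : f ≤ |r| := by
      have := posPart_inf_negPart_nsmul_le (T v) r k (n - k)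
      have e1 : k • T v + r = T x := by rw [hr]; abel
      have e2 : (n - k) • T v - r = T y := by
        rw [hTy, hr]
        nth_rewrite 2 [← Nat.sub_add_cancel hk]
        rw [add_nsmul]; abel
      rwa [e1, e2] at this
    have hhe : h ≤ |e| := by
      refine hhg.trans (sup_le ?_ (abs_nonneg _))
      rw [sub_le_iff_le_add']
      exact hfr.trans hre
    have hhe0 : h ⊓ |e| = 0 := by
      refine inf_eq_zero_of_le h0 (abs_nonneg e) le_rfl ?_
        (inf_add_eq_zero h0 (abs_nonneg _) (abs_nonneg _) hb ha)
      have := abs_add_le (T (s - v)⁺) (-T s⁻)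
      rwa [abs_neg, ← sub_eq_add_neg] at this
    rw [← hhe0]
    exact (inf_eq_left.2 hhe).symm
  have hind : ∀ k ≤ n + 1, g ⊓ |T (x - k • v)⁻| = 0 := by
    intro k
    induction k with
    | zero =>
      intro _
      rw [zero_nsmul, sub_zero, negPart_eq_zero.2 hx, map_zero, abs_zero]
      exact inf_eq_right.2 hg0
    | succ k ih =>
      intro hk
      have hd : |T (x - (k + 1) • v)⁻| ⊓ |T (x - (k + 1) • v)⁺| = 0 :=
        (hT _ _ (disj_posPart_negPart _)).symm
      refine step k (by omega) _ (le_inf hg0 (abs_nonneg _)) inf_le_left ?_ ?_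
      · exact inf_eq_zero_of_le (le_inf hg0 (abs_nonneg _)) (abs_nonneg _) inf_le_left le_rfl
          (ih (by omega))
      · exact inf_eq_zero_of_le (le_inf hg0 (abs_nonneg _)) (abs_nonneg _) inf_le_right le_rfl hd
  have hfin : g = 0 := by
    refine step n le_rfl g hg0 le_rfl (hind n (by omega)) ?_
    have : x - (n + 1) • v ≤ 0 := by
      rw [succ_nsmul, ← hxy, sub_nonpos, add_assoc]
      exact le_add_of_nonneg_right (add_nonneg hy hv)
    rw [posPart_eq_zero.2 this, map_zero, abs_zero]
    exact inf_eq_right.2 hg0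
  exact sub_nonpos.1 (posPart_eq_zero.1 hfin)

variable {E : Type u} [AddCommGroup E] [Lattice E] [IsOrderedAddMonoid E]
  [Module ℝ E] [IsOrderedModule ℝ E]
  {F : Type v} [NormedAddCommGroup F] [Lattice F] [HasSolidNorm F] [IsOrderedAddMonoid F]
  [NormedSpace ℝ F] [IsOrderedModule ℝ F]

/-- Taking `v = (x + y) / (n + 1)` shrinks an order bound for `T` on `[0, x + y]` by the factor `n +
1`; let `n → ∞`. -/
theorem DisjointnessPreserving.posPart_inf_negPart_eq_zero {T : E →ₗ[ℝ] F}
    (hT : DisjointnessPreserving T) (hb : OrderBoundedOperator T) {x y : E}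
    (hx : 0 ≤ x) (hy : 0 ≤ y) : (T x)⁺ ⊓ (T y)⁻ = 0 := by
  obtain ⟨A, B, hAB⟩ := hb (Set.Icc 0 (x + y)) ⟨_, _, subset_rfl⟩
  have hW : ∀ w, 0 ≤ w → w ≤ x + y → |T w| ≤ |A| + |B| := fun w h0 h1 => by
    obtain ⟨ha, hb⟩ := hAB ⟨w, ⟨h0, h1⟩, rfl⟩
    refine abs_le'.2 ⟨?_, ?_⟩
    · exact (hb.trans (le_abs_self B)).trans (le_add_of_nonneg_left (abs_nonneg A))
    · exact ((neg_le_neg ha).trans (neg_le_abs A)).trans (le_add_of_nonneg_right (abs_nonneg B))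
  refine eq_zero_of_forall_le_smul (w := |A| + |B|)
    (le_inf (posPart_nonneg _) (negPart_nonneg _)) fun n => ?_
  have hn : (0 : ℝ) < (n : ℝ) + 1 := by positivity
  have hn' : (0 : ℝ) ≤ 1 / ((n : ℝ) + 1) := by positivity
  refine hT.posPart_inf_negPart_le (n := n + 1) (v := (1 / ((n : ℝ) + 1)) • (x + y)) hx hy
    (smul_nonneg hn' (add_nonneg hx hy)) ?_ fun w h0 h1 => ?_
  · rw [← Nat.cast_smul_eq_nsmul ℝ, smul_smul, Nat.cast_add, Nat.cast_one,
      mul_one_div_cancel hn.ne', one_smul]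
  · have h2 : ((n : ℝ) + 1) • w ≤ x + y := by
      have := smul_le_smul_of_nonneg_left h1 hn.le
      rwa [smul_smul, mul_one_div_cancel hn.ne', one_smul] at this
    have h3 := smul_le_smul_of_nonneg_left (hW _ (smul_nonneg hn.le h0) h2) hn'
    rwa [map_smul, abs_smul_of_nonneg hn.le, smul_smul, one_div_mul_cancel hn.ne', one_smul] at h3

theorem isModulus_of_eq_abs {T R : E →ₗ[ℝ] F} (hR : ∀ x, 0 ≤ x → R x = |T x|) :
    IsModulus T R := by
  refine ⟨fun x hx => ?_, fun x hx => ?_, fun S h1 h2 x hx => ?_⟩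
  · rw [hR x hx]; exact le_abs_self _
  · rw [hR x hx]; exact neg_le_abs _
  · rw [hR x hx]; exact abs_le'.2 ⟨h1 x hx, h2 x hx⟩

/-- Meyer's theorem: an order bounded disjointness preserving operator has a modulus, and
`|T| x = |T x|` for `x ≥ 0`. -/
theorem DisjointnessPreserving.exists_modulus {T : E →ₗ[ℝ] F}
    (hT : DisjointnessPreserving T) (hb : OrderBoundedOperator T)
    (hu : SigmaUonContinuous T) :
    ∃ R : E →ₗ[ℝ] F, IsModulus T R ∧ SigmaUonContinuous R := by
  obtain ⟨R, hR⟩ := exists_linearMap_of_cone (fun x => |T x|)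
    (fun x y hx hy => by
      simp only [map_add]
      exact abs_add_eq_of_posPart_inf_negPart (hT.posPart_inf_negPart_eq_zero hb hx hy)
        (hT.posPart_inf_negPart_eq_zero hb hy hx))
    (fun c x hc _ => by simp only [map_smul]; exact abs_smul_of_nonneg hc _)
  refine ⟨R, isModulus_of_eq_abs hR, fun x hx => ?_⟩
  refine squeeze_zero_norm (fun n => ?_) (tendsto_zero_iff_norm_tendsto_zero.1 (hu x hx))
  refine norm_le_norm_of_abs_le_abs ?_
  refine (abs_apply_le_of_pos (fun z hz => by rw [hR z hz]; exact abs_nonneg _) (x n)).trans ?_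
  rw [← posPart_add_negPart (x n), map_add, hR _ (posPart_nonneg _), hR _ (negPart_nonneg _)]
  refine (hT _ _ (disj_posPart_negPart (x n))).abs_add_abs_le.trans ?_
  rw [← map_sub, posPart_sub_negPart]

end DisjointnessPreserving

end RieszSpace

namespace RieszSpace

/-! ### Sources of `uo`-null sequences. -/

section UOConvergence

variable {E : Type u} [AddCommGroup E] [Lattice E] [IsOrderedAddMonoid E]

theorem UOConverges.of_abs_le {x y : ℕ → E} (hx : UOConverges x 0) (h : ∀ n, |y n| ≤ |x n|) :
    UOConverges y 0 := by
  intro w hw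
  obtain ⟨β, i1, i2, i3, z, hz, hd⟩ := hx w hw
  refine ⟨β, i1, i2, i3, z, hz, fun b => ?_⟩
  obtain ⟨i₀, hi⟩ := hd b
  refine ⟨i₀, fun i h0 => (?_ : _ ≤ _).trans (hi i h0)⟩
  simp only [sub_zero]
  rw [abs_of_nonneg (le_inf (abs_nonneg _) hw), abs_of_nonneg (le_inf (abs_nonneg _) hw)]
  exact inf_le_inf (h i) le_rfl

theorem OrderConverges.of_antitone {s z : ℕ → E} (hz : Antitone z) (hz0 : IsGLB (Set.range z) 0)
    (h : ∀ n, |s n| ≤ z n) : OrderConverges s 0 := by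
  -- `ULift` moves the index set into the universe that `OrderConverges` requires.
  refine ⟨ULift.{u} ℕ, inferInstance, ⟨fun a b => ⟨⟨max a.down b.down⟩, ?_, ?_⟩⟩, ⟨⟨0⟩⟩,
    fun n => z n.down, ⟨fun a b hab => hz hab, ?_⟩, fun b => ⟨b.down, fun i hi => ?_⟩⟩
  · exact le_max_left a.down b.down
  · exact le_max_right a.down b.down
  · convert hz0 using 1
    exact ULift.down_surjective.range_comp z
  · rw [sub_zero]; exact (h i).trans (hz hi)

theorem UOConverges.of_antitone {z : ℕ → E} (hz : Antitone z) (hz0 : IsGLB (Set.range z) 0) :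
    UOConverges z 0 := fun w hw => by
  have h0 : ∀ n, 0 ≤ z n := fun n => hz0.1 ⟨n, rfl⟩
  refine OrderConverges.of_antitone hz hz0 fun n => ?_
  rw [sub_zero, abs_of_nonneg (le_inf (abs_nonneg _) hw), abs_of_nonneg (h0 n)]
  exact inf_le_left

/-- For `x ∈ s`, `t + x = t ⊔ x ≤ z`, so `z - t` is still an upper bound of `s`. -/
theorem le_zero_of_isLUB_of_disjoint {s : Set E} {z t : E} (hz : IsLUB s z)
    (ht : t ≤ z) (hd : ∀ x ∈ s, t ⊓ x = 0) : t ≤ 0 := by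
  have : z ≤ z - t := hz.2 fun x hx => by
    rw [le_sub_iff_add_le, add_comm, add_eq_sup_of_inf_eq_zero (hd x hx)]
    exact sup_le ht (hz.1 hx)
  simpa using this

/-- In a Dedekind `σ`-complete vector lattice every disjoint sequence is `uo`-null. -/
theorem UOConverges.of_disjoint (hE : DedekindSigmaComplete E) {y : ℕ → E}
    (hy : Pairwise fun m n => Disj (y m) (y n)) : UOConverges y 0 := by
  intro w hw
  set d : ℕ → E := fun n => |y n| ⊓ w with hd
  have hd0 : ∀ n, 0 ≤ d n := fun n => le_inf (abs_nonneg _) hw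
  have hdd : ∀ m n, m ≠ n → d m ⊓ d n = 0 := fun m n hmn =>
    inf_eq_zero_of_le (hd0 m) (hd0 n) inf_le_left inf_le_left (hy hmn)
  have hex : ∀ n, ∃ z, IsLUB (d '' Set.Ici n) z := fun n =>
    hE _ ⟨d n, n, Set.mem_Ici.2 le_rfl, rfl⟩ ((Set.to_countable _).image d)
      ⟨w, by rintro _ ⟨k, -, rfl⟩; exact inf_le_right⟩
  choose z hz using hex
  have hz0 : ∀ n, 0 ≤ z n := fun n => (hd0 n).trans ((hz n).1 ⟨n, Set.mem_Ici.2 le_rfl, rfl⟩)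
  refine OrderConverges.of_antitone (z := z) (fun m n hmn => ?_) ⟨?_, fun t ht => ?_⟩ fun n => ?_
  · exact (hz n).mono (hz m) (Set.image_mono (Set.Ici_subset_Ici.2 hmn))
  · rintro _ ⟨n, rfl⟩; exact hz0 n
  · have htz : ∀ n, t⁺ ≤ z n := fun n => sup_le (ht ⟨n, rfl⟩) (hz0 n)
    have ht0 : t⁺ ≤ 0 := by
      refine le_zero_of_isLUB_of_disjoint (hz 0) (htz 0) ?_
      rintro _ ⟨k, -, rfl⟩
      -- `t⁺ ⊓ d k` lies below the supremum of the tail from `k + 1`, all of whose terms are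
      -- disjoint from `d k`.
      refine le_antisymm ?_ (le_inf (posPart_nonneg _) (hd0 k))
      refine le_zero_of_isLUB_of_disjoint (hz (k + 1)) (inf_le_left.trans (htz _)) ?_
      rintro _ ⟨j, hj, rfl⟩
      exact inf_eq_zero_of_le (le_inf (posPart_nonneg _) (hd0 k)) (hd0 j) inf_le_right le_rfl
        (hdd k j (by have := Set.mem_Ici.1 hj; omega))
    exact (le_posPart t).trans ht0
  · rw [sub_zero, abs_of_nonneg (le_inf (abs_nonneg _) hw)]
    exact (hz n).1 ⟨n, Set.mem_Ici.2 le_rfl, rfl⟩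

end UOConvergence

/-! ### Principal band projections. -/

section BandProjection

variable {E : Type u} [AddCommGroup E] [Lattice E] [IsOrderedAddMonoid E]
  [Module ℝ E] [IsOrderedModule ℝ E]

/-- In a Dedekind `σ`-complete vector lattice, principal bands are projection bands. -/
theorem exists_bandProjection (hE : DedekindSigmaComplete E) {a : E} (ha : 0 ≤ a) :
    ∃ P : E →ₗ[ℝ] E, ∀ x, 0 ≤ x →
      IsLUB (Set.range fun n : ℕ => x ⊓ n • a) (P x) ∧ 0 ≤ P x ∧ P x ≤ x ∧ (x - P x) ⊓ a = 0 := by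
  have hex : ∀ x : E, ∃ p, IsLUB (Set.range fun n : ℕ => x ⊓ n • a) p := fun x =>
    hE _ (Set.range_nonempty _) (Set.countable_range _)
      ⟨x, by rintro _ ⟨n, rfl⟩; exact inf_le_left⟩
  choose p hp using hex
  have hmem : ∀ x (n : ℕ), x ⊓ n • a ≤ p x := fun x n => (hp x).1 ⟨n, rfl⟩
  have hle : ∀ x, p x ≤ x := fun x => (hp x).2 (by rintro _ ⟨n, rfl⟩; exact inf_le_left)
  have h0 : ∀ x, 0 ≤ x → 0 ≤ p x := fun x hx =>
    (le_inf hx (by simp)).trans (hmem x 0)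
  have hadd : ∀ x y, 0 ≤ x → 0 ≤ y → p (x + y) = p x + p y := fun x y hx hy => by
    refine le_antisymm ((hp _).2 ?_) ?_
    · rintro _ ⟨n, rfl⟩
      refine le_trans ?_ (add_le_add (hmem x n) (hmem y n))
      have hna : 0 ≤ n • a := nsmul_nonneg ha n
      change (x + y) ⊓ n • a ≤ _
      rw [inf_comm, inf_comm x, inf_comm y]
      exact inf_add_le_of_nonneg hna hx hy
    · rw [← le_sub_iff_add_le]
      refine (hp x).2 ?_
      rintro _ ⟨m, rfl⟩
      change x ⊓ m • a ≤ _
      rw [le_sub_comm]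
      refine (hp y).2 ?_
      rintro _ ⟨n, rfl⟩
      rw [le_sub_iff_add_le, add_comm]
      refine (le_inf (add_le_add inf_le_left inf_le_left) ?_).trans (hmem _ (m + n))
      rw [add_nsmul]
      exact add_le_add inf_le_right inf_le_right
  have hsmul : ∀ (c : ℝ) x, 0 ≤ c → 0 ≤ x → p (c • x) = c • p x := fun c x hc hx => by
    have key : ∀ (c : ℝ) (x : E), 0 < c → 0 ≤ x → c • p x ≤ p (c • x) := fun c x hc hx => by
      have hi : 0 ≤ c⁻¹ := inv_nonneg.2 hc.le
      have h : p x ≤ c⁻¹ • p (c • x) := (hp x).2 <| by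
        rintro _ ⟨n, rfl⟩
        obtain ⟨m, hm⟩ := exists_nat_ge (c * n)
        have h1 : c • (x ⊓ n • a) ≤ p (c • x) := by
          refine le_trans ?_ (hmem (c • x) m)
          rw [smul_inf_of_nonneg hc.le]
          refine inf_le_inf le_rfl ?_
          rw [← Nat.cast_smul_eq_nsmul ℝ, ← Nat.cast_smul_eq_nsmul ℝ, smul_smul]
          exact smul_le_smul_of_nonneg_right hm ha
        have := smul_le_smul_of_nonneg_left h1 hi
        rwa [smul_smul, inv_mul_cancel₀ hc.ne', one_smul] at this
      have := smul_le_smul_of_nonneg_left h hc.le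
      rwa [smul_smul, mul_inv_cancel₀ hc.ne', one_smul] at this
    rcases hc.eq_or_lt with rfl | hc
    · rw [zero_smul, zero_smul]
      exact le_antisymm (hle 0) (h0 0 le_rfl)
    · refine le_antisymm ?_ (key c x hc hx)
      have h := smul_le_smul_of_nonneg_left
        (key c⁻¹ (c • x) (inv_pos.2 hc) (smul_nonneg hc.le hx)) hc.le
      rwa [smul_smul, smul_smul, mul_inv_cancel₀ hc.ne', inv_mul_cancel₀ hc.ne', one_smul,
        one_smul] at h
  obtain ⟨P, hP⟩ := exists_linearMap_of_cone p hadd hsmul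
  refine ⟨P, fun x hx => ?_⟩
  rw [hP x hx]
  refine ⟨hp x, h0 x hx, hle x, le_antisymm ?_ (le_inf (sub_nonneg.2 (hle x)) ha)⟩
  set w := (x - p x) ⊓ a
  -- Adding `w` to `x ⊓ n • a` stays below `x ⊓ (n + 1) • a`, so `p x - w` is also an upper bound.
  have : p x ≤ p x - w := (hp x).2 <| by
    rintro _ ⟨n, rfl⟩
    rw [le_sub_iff_add_le]
    refine (le_inf ?_ ?_).trans (hmem x (n + 1))
    · calc x ⊓ n • a + w ≤ p x + (x - p x) := add_le_add (hmem x n) inf_le_left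
        _ = x := by abel
    · rw [succ_nsmul]; exact add_le_add inf_le_right inf_le_right
  simpa using this

end BandProjection

/-! ### Operator atoms and reduction to the disjointness preserving case. -/

section Atoms

variable {E : Type u} [AddCommGroup E] [Lattice E] [IsOrderedAddMonoid E]
  [Module ℝ E] [IsOrderedModule ℝ E]

/-- `T` vanishes on every vector whose modulus is dominated by `u`. -/
def VanishesBelow {V : Type v} [AddCommGroup V] [Module ℝ V] (T : E →ₗ[ℝ] V) (u : E) : Prop :=
  ∀ y, |y| ≤ u → T y = 0

/-- `a ≥ 0` cannot be split into two disjoint parts on both of which `T` acts nontrivially. -/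
def IsOperatorAtom {V : Type v} [AddCommGroup V] [Module ℝ V] (T : E →ₗ[ℝ] V) (a : E) : Prop :=
  0 ≤ a ∧ ∀ b ∈ Set.Icc 0 a, ∀ c ∈ Set.Icc 0 a, Disj b c → VanishesBelow T b ∨ VanishesBelow T c

variable {F : Type v} [NormedAddCommGroup F] [Lattice F] [HasSolidNorm F] [IsOrderedAddMonoid F]
  [NormedSpace ℝ F] [IsOrderedModule ℝ F]

theorem SigmaUonContinuous.exists_apply_eq_zero (hE : DedekindSigmaComplete E) {T : E →ₗ[ℝ] F}
    (hu : SigmaUonContinuous T) {y : ℕ → E} (hy : Pairwise fun m n => Disj (y m) (y n)) :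
    ∃ n, T (y n) = 0 := by
  by_contra! h
  -- Normalising the images to norm one keeps the sequence disjoint, hence `uo`-null: a
  -- contradiction.
  have h1 := hu (fun n => ‖T (y n)‖⁻¹ • y n) (UOConverges.of_disjoint hE fun m n hmn =>
    (hy hmn).smul_smul (inv_nonneg.2 (norm_nonneg _)) (inv_nonneg.2 (norm_nonneg _)))
  have h2 : ∀ n, ‖T (‖T (y n)‖⁻¹ • y n)‖ = 1 := fun n => by
    rw [map_smul, norm_smul, norm_inv, norm_norm, inv_mul_cancel₀ (norm_ne_zero_iff.2 (h n))]
  have h3 := h1.norm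
  simp only [h2, norm_zero] at h3
  exact one_ne_zero (tendsto_nhds_unique tendsto_const_nhds h3)

theorem SigmaUonContinuous.exists_vanishesBelow (hE : DedekindSigmaComplete E) {T : E →ₗ[ℝ] F}
    (hu : SigmaUonContinuous T) {a : ℕ → E}
    (hd : Pairwise fun m n => a m ⊓ a n = 0) : ∃ n, VanishesBelow T (a n) := by
  by_contra! h
  simp only [VanishesBelow, not_forall] at h
  choose y hy hy0 using h
  obtain ⟨n, hn⟩ := hu.exists_apply_eq_zero hE (y := y) fun m n hmn =>
    inf_eq_zero_of_le (abs_nonneg _) (abs_nonneg _) (hy m) (hy n) (hd hmn)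
  exact hy0 n hn

/-- Otherwise every piece splits again: keep `b`, continue with `c`. The kept pieces form a disjoint
sequence on none of which `T` vanishes. -/
theorem SigmaUonContinuous.exists_operatorAtom_le (hE : DedekindSigmaComplete E)
    {T : E →ₗ[ℝ] F} (hu : SigmaUonContinuous T) {x : E} (hx : 0 ≤ x)
    (hTx : ¬ VanishesBelow T x) :
    ∃ a, IsOperatorAtom T a ∧ ¬ VanishesBelow T a ∧ a ≤ x := by
  by_contra! hno
  have hsplit : ∀ s : {s : E // 0 ≤ s ∧ s ≤ x ∧ ¬ VanishesBelow T s},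
      ∃ (b : E) (c : {s : E // 0 ≤ s ∧ s ≤ x ∧ ¬ VanishesBelow T s}),
        0 ≤ b ∧ b ≤ s.1 ∧ c.1 ≤ s.1 ∧ b ⊓ c.1 = 0 ∧ ¬ VanishesBelow T b := by
    rintro ⟨s, hs0, hsx, hs⟩
    have : ¬ IsOperatorAtom T s := fun h => hno s h hs hsx
    simp only [IsOperatorAtom, not_and, not_forall, not_or] at this
    obtain ⟨b, hb, c, hc, hd, hbv, hcv⟩ := this hs0
    refine ⟨b, ⟨c, hc.1, hc.2.trans hsx, hcv⟩, hb.1, hb.2, hc.2, ?_, hbv⟩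
    rwa [Disj, abs_of_nonneg hb.1, abs_of_nonneg hc.1] at hd
  choose b c hb0 hb hc hbc hbv using hsplit
  let s : ℕ → {s : E // 0 ≤ s ∧ s ≤ x ∧ ¬ VanishesBelow T s} :=
    fun n => Nat.rec ⟨x, hx, le_rfl, hTx⟩ (fun _ t => c t) n
  have hs : Antitone fun n => (s n).1 := antitone_nat_of_succ_le fun n => hc (s n)
  have hlt : ∀ m n, m < n → b (s m) ⊓ b (s n) = 0 := fun m n hmn =>
    inf_eq_zero_of_le (hb0 _) (hb0 _) le_rfl ((hb (s n)).trans (hs (Nat.succ_le_of_lt hmn)))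
      (hbc (s m))
  obtain ⟨n, hn⟩ := hu.exists_vanishesBelow hE (a := fun n => b (s n))
    fun m n hmn => by
      rcases hmn.lt_or_gt with h | h
      · exact hlt m n h
      · exact (inf_comm _ _).trans (hlt n m h)
  exact hbv _ hn

/-- If no finite set sufficed, one could keep choosing atoms disjoint from the earlier ones, giving
a forbidden infinite disjoint sequence. -/
theorem SigmaUonContinuous.exists_finset_operatorAtom (hE : DedekindSigmaComplete E)
    {T : E →ₗ[ℝ] F} (hu : SigmaUonContinuous T) :
    ∃ s : Finset E, (∀ a ∈ s, IsOperatorAtom T a) ∧ ∀ x, (∀ a ∈ s, |x| ⊓ a = 0) → T x = 0 := by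
  by_contra! hno
  have : Std.Symm fun a b : E => a ⊓ b = 0 := ⟨fun a b h => (inf_comm _ _).trans h⟩
  obtain ⟨f, hf, hd⟩ := exists_seq_of_forall_finset_exists'
    (fun a => IsOperatorAtom T a ∧ ¬ VanishesBelow T a) (fun a b : E => a ⊓ b = 0)
    fun s hs => by
      obtain ⟨x, hx, hTx⟩ := hno s fun a ha => (hs a ha).1
      obtain ⟨a, ha, hav, hax⟩ := hu.exists_operatorAtom_le hE (abs_nonneg x)
        fun h => hTx (h x le_rfl)
      refine ⟨a, ⟨ha, hav⟩, fun b hb => ?_⟩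
      rw [inf_comm]
      exact inf_eq_zero_of_le ha.1 (hs b hb).1.1 hax le_rfl (hx b hb)
  obtain ⟨n, hn⟩ := hu.exists_vanishesBelow hE hd
  exact (hf n).2 hn

theorem SigmaUonContinuous.comp_of_abs_le {T : E →ₗ[ℝ] F} (hu : SigmaUonContinuous T)
    {P : E →ₗ[ℝ] E} (hP : ∀ x, |P x| ≤ |x|) : SigmaUonContinuous (T ∘ₗ P) :=
  fun x hx => hu (fun n => P (x n)) (hx.of_abs_le fun n => hP (x n))

theorem OrderBoundedOperator.comp_of_pos {T : E →ₗ[ℝ] F} (hb : OrderBoundedOperator T)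
    {P : E →ₗ[ℝ] E} (hP : ∀ x, 0 ≤ x → 0 ≤ P x) : OrderBoundedOperator (T ∘ₗ P) := by
  rintro A ⟨l, r, hA⟩
  have hmono : ∀ {x y}, x ≤ y → P x ≤ P y := fun {x y} h => by
    simpa using hP _ (sub_nonneg.2 h)
  obtain ⟨l', r', h⟩ := hb (P '' A) ⟨P l, P r, by
    rintro _ ⟨x, hx, rfl⟩
    exact ⟨hmono (hA hx).1, hmono (hA hx).2⟩⟩
  exact ⟨l', r', by rintro _ ⟨x, hx, rfl⟩; exact h ⟨_, ⟨x, hx, rfl⟩, rfl⟩⟩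

/-- `T` kills each `x ⊓ n • a`, as a multiple of a vector below `x ⊓ a`. The differences `p - x ⊓ n
• a` decrease to `0`, so their constant image `T p` is `0`. -/
theorem apply_bandProjection_eq_zero {T : E →ₗ[ℝ] F} (hu : SigmaUonContinuous T) {a x p : E}
    (ha : 0 ≤ a) (hx : 0 ≤ x) (hp : IsLUB (Set.range fun n : ℕ => x ⊓ n • a) p)
    (hv : VanishesBelow T (x ⊓ a)) : T p = 0 := by
  have hn : ∀ n : ℕ, T (x ⊓ n • a) = 0 := fun n => by
    have h0 : (0 : ℝ) < (n : ℝ) + 1 := by positivity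
    have h1 : ((n : ℝ) + 1)⁻¹ • (x ⊓ n • a) ≤ x ⊓ a := by
      have : x ⊓ n • a ≤ ((n : ℝ) + 1) • (x ⊓ a) := by
        rw [smul_inf_of_nonneg h0.le]
        refine inf_le_inf ?_ ?_
        · rw [add_smul, one_smul]
          exact le_add_of_nonneg_left (smul_nonneg n.cast_nonneg hx)
        · rw [← Nat.cast_smul_eq_nsmul ℝ]
          exact smul_le_smul_of_nonneg_right (by linarith) ha
      have := smul_le_smul_of_nonneg_left this (inv_nonneg.2 h0.le)
      rwa [smul_smul, inv_mul_cancel₀ h0.ne', one_smul] at this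
    have h2 := hv (((n : ℝ) + 1)⁻¹ • (x ⊓ n • a)) (by
      rw [abs_of_nonneg]
      · exact h1
      · exact smul_nonneg (inv_nonneg.2 h0.le) (le_inf hx (nsmul_nonneg ha n)))
    rw [map_smul] at h2
    exact (smul_eq_zero.1 h2).resolve_left (inv_ne_zero h0.ne')
  have hconv : UOConverges (fun n : ℕ => p - x ⊓ n • a) 0 := by
    refine UOConverges.of_antitone (fun m n hmn => ?_) ⟨?_, fun t ht => ?_⟩
    · exact sub_le_sub_left (inf_le_inf le_rfl (nsmul_le_nsmul_left ha hmn)) p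
    · rintro _ ⟨n, rfl⟩; exact sub_nonneg.2 (hp.1 ⟨n, rfl⟩)
    · have : p ≤ p - t := hp.2 <| by
        rintro _ ⟨n, rfl⟩
        have := ht ⟨n, rfl⟩
        exact le_sub_comm.1 this
      simpa using this
  have := hu _ hconv
  simp only [map_sub, hn, sub_zero] at this
  exact tendsto_nhds_unique tendsto_const_nhds this

theorem IsModulus.add_comp {T R₁ R₂ : E →ₗ[ℝ] F} {P Q : E →ₗ[ℝ] E} (hPQ : P + Q = LinearMap.id)
    (hP : ∀ x, 0 ≤ x → 0 ≤ P x) (hQ : ∀ x, 0 ≤ x → 0 ≤ Q x)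
    (h₁ : IsModulus (T ∘ₗ P) R₁) (h₂ : IsModulus (T ∘ₗ Q) R₂) : IsModulus T (R₁ + R₂) := by
  have hsum : ∀ (S : E →ₗ[ℝ] F) x, S x = S (P x) + S (Q x) := fun S x => by
    rw [← map_add]; exact congrArg S (LinearMap.congr_fun hPQ x).symm
  refine ⟨fun x hx => ?_, fun x hx => ?_, fun S hS hS' x hx => ?_⟩
  · rw [hsum T]; exact add_le_add (h₁.1 x hx) (h₂.1 x hx)
  · rw [hsum (-T)]; exact add_le_add (h₁.2.1 x hx) (h₂.2.1 x hx)
  · rw [hsum S]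
    exact add_le_add
      (h₁.2.2 (S ∘ₗ P) (fun y hy => hS _ (hP y hy)) (fun y hy => hS' _ (hP y hy)) x hx)
      (h₂.2.2 (S ∘ₗ Q) (fun y hy => hS _ (hQ y hy)) (fun y hy => hS' _ (hQ y hy)) x hx)

theorem exists_modulus_of_finset_operatorAtom (hE : DedekindSigmaComplete E) (s : Finset E) :
    ∀ T : E →ₗ[ℝ] F, OrderBoundedOperator T → SigmaUonContinuous T →
      (∀ a ∈ s, IsOperatorAtom T a) → (∀ x, (∀ a ∈ s, |x| ⊓ a = 0) → T x = 0) →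
      ∃ R : E →ₗ[ℝ] F, IsModulus T R ∧ SigmaUonContinuous R := by
  classical
  induction s using Finset.induction_on with
  | empty =>
    intro T _ hu _ h0
    have : ∀ x, T x = 0 := fun x => h0 x (by simp)
    exact ⟨T, isModulus_of_eq_abs fun x _ => by rw [this x, abs_zero], hu⟩
  | insert a s _ ih =>
    intro T hb hu hat h0
    obtain ⟨ha, hatom⟩ := hat a (Finset.mem_insert_self a s)
    obtain ⟨P, hP⟩ := exists_bandProjection hE ha
    have hP0 : ∀ x, 0 ≤ x → 0 ≤ P x := fun x hx => (hP x hx).2.1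
    set Q : E →ₗ[ℝ] E := LinearMap.id - P with hQ
    have hQx : ∀ x, Q x = x - P x := fun x => rfl
    have hQ0 : ∀ x, 0 ≤ x → 0 ≤ Q x := fun x hx => sub_nonneg.2 (hP x hx).2.2.1
    have hPabs : ∀ x, |P x| ≤ |x| := fun x =>
      (abs_apply_le_of_pos hP0 x).trans (hP _ (abs_nonneg x)).2.2.1
    have hQabs' : ∀ x, |Q x| ≤ Q |x| := abs_apply_le_of_pos hQ0
    have hQabs : ∀ x, |Q x| ≤ |x| := fun x =>
      (hQabs' x).trans (sub_le_self _ (hP0 _ (abs_nonneg x)))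
    have hzero : ∀ x, VanishesBelow T (|x| ⊓ a) → T (P x) = 0 := fun x hx => by
      have key : ∀ y, 0 ≤ y → y ≤ |x| → T (P y) = 0 := fun y hy hyx =>
        apply_bandProjection_eq_zero hu ha hy (hP y hy).1
          fun z hz => hx z (hz.trans (inf_le_inf hyx le_rfl))
      rw [← posPart_sub_negPart x, map_sub, map_sub,
        key _ (posPart_nonneg x) (posPart_le_abs x), key _ (negPart_nonneg x) (negPart_le_abs x),
        sub_zero]
    -- For disjoint `x` and `y`, the atom `a` forces `T` to vanish below `|x| ⊓ a` or below `|y| ⊓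
    -- a`, so `T (P x)` or `T (P y)` is `0`.
    have hdp : DisjointnessPreserving (T ∘ₗ P) := fun x y hxy => by
      have hi : ∀ z : E, 0 ≤ |z| ⊓ a := fun z => le_inf (abs_nonneg z) ha
      rcases hatom (|x| ⊓ a) ⟨hi x, inf_le_right⟩ (|y| ⊓ a) ⟨hi y, inf_le_right⟩ (by
        rw [Disj, abs_of_nonneg (hi x), abs_of_nonneg (hi y)]
        exact inf_eq_zero_of_le (hi x) (hi y) inf_le_left inf_le_left hxy) with h | h
      · rw [Disj, LinearMap.comp_apply, hzero x h, abs_zero]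
        exact inf_eq_left.2 (abs_nonneg _)
      · rw [Disj, LinearMap.comp_apply, LinearMap.comp_apply, hzero y h, abs_zero]
        exact inf_eq_right.2 (abs_nonneg _)
    obtain ⟨R₁, hR₁, hu₁⟩ := hdp.exists_modulus (hb.comp_of_pos hP0) (hu.comp_of_abs_le hPabs)
    obtain ⟨R₂, hR₂, hu₂⟩ := ih (T ∘ₗ Q) (hb.comp_of_pos hQ0) (hu.comp_of_abs_le hQabs)
      (fun b hbs => by
        obtain ⟨hb0, hbat⟩ := hat b (Finset.mem_insert_of_mem hbs)
        have hmono : ∀ c, VanishesBelow T c → VanishesBelow (T ∘ₗ Q) c := fun c hc y hy =>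
          hc _ ((hQabs y).trans hy)
        exact ⟨hb0, fun c hc d hd hcd => (hbat c hc d hd hcd).imp (hmono c) (hmono d)⟩)
      -- `Q x` is automatically disjoint from `a`, so `a` can be dropped from the list of atoms.
      (fun x hx => h0 (Q x) fun b hbs => by
        rcases Finset.mem_insert.1 hbs with rfl | hbs
        · exact inf_eq_zero_of_le (abs_nonneg _) ha (hQabs' x) le_rfl (hP _ (abs_nonneg x)).2.2.2
        · exact inf_eq_zero_of_le (abs_nonneg _) (hat b (Finset.mem_insert_of_mem hbs)).1
            (hQabs x) le_rfl (hx b hbs))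
    refine ⟨R₁ + R₂, hR₁.add_comp (by rw [hQ]; abel) hP0 hQ0 hR₂, fun x hx => ?_⟩
    simpa using (hu₁ x hx).add (hu₂ x hx)

end Atoms

end RieszSpace

theorem mainTheorem2
    {E : Type u} [AddCommGroup E] [Lattice E] [IsOrderedAddMonoid E]
    [Module ℝ E] [IsOrderedModule ℝ E]
    {F : Type v} [NormedAddCommGroup F] [Lattice F] [HasSolidNorm F] [IsOrderedAddMonoid F]
    [NormedSpace ℝ F] [IsOrderedModule ℝ F]
    (T : E →ₗ[ℝ] F)
    (hT : RieszSpace.OrderBoundedOperator T)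
    (hTuon : RieszSpace.SigmaUonContinuous T)
    (h : (RieszSpace.DedekindSigmaComplete E ∧ RieszSpace.LaterallySigmaComplete E ∧
          RieszSpace.IsAtomicLattice F ∧ RieszSpace.OrderContinuousNorm F) ∨
        RieszSpace.DisjointnessPreserving T) :
    ∃ R : E →ₗ[ℝ] F, RieszSpace.IsModulus T R ∧ RieszSpace.SigmaUonContinuous R := by
  rcases h with ⟨hE, -, -, -⟩ | hd
  · obtain ⟨s, hs, h0⟩ := hTuon.exists_finset_operatorAtom hE
    exact RieszSpace.exists_modulus_of_finset_operatorAtom hE s T hT hTuon hs h0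
  · exact hd.exists_modulus hT hTuon
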